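/- **Theorem 1.4.** All groups are finite. Call a group $H$ a coprime direct factor of a group $G$ if there is a group $K$ such that $G \cong H \times K$ and $|H|$, $|K|$ are coprime. Call a family $\mathscr{F}$ of groups cyclic bounded (CB) if, for every natural number $n$, there are, up to isomorphism, only finitely many groups in $\mathscr{F}$ with at most $n$ cyclic subgroups. Then the family of all groups that have no nontrivial cyclic coprime direct factor is CB. -/

import Mathlib

universe u

/-- `c(G)`: the number of cyclic subgroups of the finite group `G`. -/
noncomputable def numCyclicSubgroups (G : FiniteGrp.{u}) : ℕ :=
  Nat.card {C : Subgroup G // IsCyclic C}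

/-- `H` is a coprime direct factor of `G`: there is a group `K` with `G ≅ H × K` and
`|H|`, `|K|` coprime. (`K` embeds in `G`, so it may be taken in the same universe.) -/
def IsCoprimeDirectFactor (H G : FiniteGrp.{u}) : Prop :=
  ∃ K : FiniteGrp.{u}, Nonempty (G ≃* H × K) ∧ (Nat.card H).Coprime (Nat.card K)

/-- Two finite groups are equivalent if they are isomorphic. -/
def finiteGrpIso : Setoid FiniteGrp.{u} where
  r G H := Nonempty (G ≃* H)
  iseqv :=
    { refl := fun G => ⟨MulEquiv.refl G⟩
      symm := fun ⟨e⟩ => ⟨e.symm⟩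
      trans := fun ⟨e⟩ ⟨f⟩ => ⟨e.trans f⟩ }

/-- A family of finite groups is cyclic bounded (CB) if, for every natural number `n`, the groups
in the family with at most `n` cyclic subgroups form only finitely many isomorphism classes. -/
def IsCyclicBounded (F : Set FiniteGrp.{u}) : Prop :=
  ∀ n : ℕ, (Quotient.mk finiteGrpIso '' {G | G ∈ F ∧ numCyclicSubgroups G ≤ n}).Finite

/-- The family of finite groups without cyclic coprime direct factors, i.e. without nontrivial ones:
the trivial group is a cyclic coprime direct factor of every group. -/
def withoutCyclicCoprimeDirectFactors : Set FiniteGrp.{u} :=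
  {G | ¬ ∃ H : FiniteGrp.{u}, Nontrivial H ∧ IsCyclic H ∧ IsCoprimeDirectFactor H G}

/-!
The order of a group `G` without nontrivial cyclic coprime direct factors is bounded in terms of
its number `n` of cyclic subgroups, and there are only finitely many groups of a given order.

* Every prime divisor `p` of `|G|` is at most `n`. Suppose `p > n` and let `P` be a Sylow
  `p`-subgroup. The conjugation orbits of `P` on the at most `n < p` cyclic subgroups have
  `p`-power size, so `P` normalizes every cyclic subgroup
  (`le_normalizer_of_isPGroup_of_card_lt`). Hence a conjugate of an element of `P` generates a
  `p`-group normalized by `P`, thus lies in `P`, and `P` is normal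
  (`Sylow.normal_of_card_cyclic_lt`). By Schur–Zassenhaus `P` has a complement `K`. For `k ∈ K`
  the subgroups `P` and `⟨k⟩` normalize each other and meet trivially, so they commute, and
  `G ≅ P × K`. Finally `P` is cyclic: otherwise its at most `n` cyclic subgroups, each of order at
  most `|P| / p`, could not cover it (`IsPGroup.isCyclic_of_card_cyclic_lt`).
* The order `m` of an element `g` divides `(n!) ^ n`: its prime divisors are at most `n`, and if
  `p ^ a ∣ m` then the cyclic subgroups `⟨g ^ (p ^ i)⟩`, `i ≤ a`, are distinct, so that `a < n`.
* As `G` is the union of its cyclic subgroups, `|G| ≤ n * (n!) ^ n`.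
-/

/-! ### Counting cyclic subgroups -/

/-- A finite group is the union of its cyclic subgroups, so its order is at most their number
times the largest order of an element. -/
theorem card_le_card_cyclic_mul {G : Type*} [Group G] [Finite G] {M : ℕ}
    (hM : ∀ g : G, orderOf g ≤ M) :
    Nat.card G ≤ Nat.card {C : Subgroup G // IsCyclic C} * M := by
  have hC (C : {C : Subgroup G // IsCyclic C}) : Nat.card C.1 ≤ M := by
    obtain ⟨g, hg⟩ := (Subgroup.isCyclic_iff_exists_zpowers_eq_top C.1).1 C.2
    rw [← hg, Nat.card_zpowers]
    exact hM g
  have hsurj : Function.Surjective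
      (fun x : Σ C : {C : Subgroup G // IsCyclic C}, C.1 => (x.2 : G)) := fun g =>
    ⟨⟨⟨Subgroup.zpowers g, inferInstance⟩, ⟨g, Subgroup.mem_zpowers g⟩⟩, rfl⟩
  have := Fintype.ofFinite {C : Subgroup G // IsCyclic C}
  calc Nat.card G ≤ Nat.card (Σ C : {C : Subgroup G // IsCyclic C}, C.1) :=
        Nat.card_le_card_of_surjective _ hsurj
    _ = ∑ C : {C : Subgroup G // IsCyclic C}, Nat.card C.1 := Nat.card_sigma
    _ ≤ ∑ _C : {C : Subgroup G // IsCyclic C}, M := Finset.sum_le_sum fun C _ => hC C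
    _ = _ := by simp [Nat.card_eq_fintype_card]

theorem card_cyclic_subgroup_le {G : Type*} [Group G] [Finite G] (H : Subgroup G) :
    Nat.card {C : Subgroup H // IsCyclic C} ≤ Nat.card {C : Subgroup G // IsCyclic C} := by
  refine Nat.card_le_card_of_injective
    (fun C => ⟨C.1.map H.subtype, ?_⟩) fun C D h => ?_
  · have := C.2
    exact isCyclic_of_surjective _
      (C.1.equivMapOfInjective H.subtype H.subtype_injective).surjective
  · exact Subtype.ext (Subgroup.map_injective H.subtype_injective (Subtype.ext_iff.1 h))

theorem factorization_orderOf_lt_card_cyclic {G : Type*} [Group G] [Finite G] (g : G) {p : ℕ}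
    (hp : p.Prime) :
    (orderOf g).factorization p < Nat.card {C : Subgroup G // IsCyclic C} := by
  let f : Fin ((orderOf g).factorization p + 1) → {C : Subgroup G // IsCyclic C} :=
    fun i => ⟨Subgroup.zpowers (g ^ p ^ (i : ℕ)), inferInstance⟩
  have hf : Function.Injective f := fun i j hij => by
    have hd (k : Fin ((orderOf g).factorization p + 1)) : p ^ (k : ℕ) ∣ orderOf g :=
      (pow_dvd_pow p (Nat.lt_succ_iff.1 k.2)).trans (Nat.ordProj_dvd _ _)
    have h : Nat.card (Subgroup.zpowers (g ^ p ^ (i : ℕ))) =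
        Nat.card (Subgroup.zpowers (g ^ p ^ (j : ℕ))) :=
      congrArg (fun C : Subgroup G => Nat.card C) (Subtype.ext_iff.1 hij)
    rw [Nat.card_zpowers, Nat.card_zpowers, orderOf_pow_of_dvd (pow_ne_zero _ hp.ne_zero) (hd i),
      orderOf_pow_of_dvd (pow_ne_zero _ hp.ne_zero) (hd j)] at h
    have hpos : 0 < orderOf g / p ^ (i : ℕ) :=
      Nat.div_pos (Nat.le_of_dvd (orderOf_pos g) (hd i)) (pow_pos hp.pos _)
    have hij' := (Nat.div_mul_cancel (hd i)).trans (Nat.div_mul_cancel (hd j)).symm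
    rw [← h] at hij'
    exact Fin.ext (Nat.pow_right_injective hp.two_le (Nat.eq_of_mul_eq_mul_left hpos hij'))
  simpa using Nat.card_le_card_of_injective f hf

/-! ### Primes larger than the number of cyclic subgroups -/

open scoped Pointwise in
/-- A `p`-subgroup permutes the cyclic subgroups by conjugation in orbits of `p`-power size, which
are trivial if there are fewer than `p` cyclic subgroups. -/
theorem le_normalizer_of_isPGroup_of_card_lt {G : Type*} [Group G] [Finite G] {p : ℕ}
    [Fact p.Prime] (hlt : Nat.card {C : Subgroup G // IsCyclic C} < p) {P : Subgroup G}
    (hP : IsPGroup p P) (C : Subgroup G) [IsCyclic C] :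
    P ≤ Subgroup.normalizer (C : Set G) := by
  let _ : MulAction P (Subgroup G) := MulAction.compHom _ ((MulAut.conj (G := G)).comp P.subtype)
  have hsmul (x : P) : x • C = C.map (MulAut.conj (x : G)).toMonoidHom := rfl
  have horb : Nat.card (MulAction.orbit P C) ≤ Nat.card {C : Subgroup G // IsCyclic C} := by
    refine Nat.card_le_card_of_injective (fun D => ⟨D.1, ?_⟩) fun D E h =>
      Subtype.ext (congrArg Subtype.val h :)
    obtain ⟨x, hx⟩ := D.2
    rw [← hx]
    change IsCyclic (C.map (MulAut.conj (x : G)).toMonoidHom)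
    exact isCyclic_of_surjective _
      (C.equivMapOfInjective _ (MulAut.conj (x : G)).injective).surjective
  obtain ⟨k, hk⟩ := hP.card_orbit C
  have hk0 : k = 0 := by
    by_contra h
    have := Nat.le_self_pow h p
    omega
  rw [hk0, pow_zero, Nat.card_eq_one_iff_unique] at hk
  have := hk.1
  have hfix (x : P) : C.map (MulAut.conj (x : G)).toMonoidHom = C :=
    Subtype.ext_iff.1 (Subsingleton.elim (⟨x • C, MulAction.mem_orbit C x⟩ : MulAction.orbit P C)
      ⟨C, MulAction.mem_orbit_self C⟩)
  intro x hx
  refine Subgroup.mem_normalizer_iff.2 fun h => ?_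
  conv_rhs => rw [← SetLike.mem_coe, ← hfix ⟨x, hx⟩]
  simp

theorem Sylow.normal_of_card_cyclic_lt {G : Type*} [Group G] [Finite G] {p : ℕ}
    [Fact p.Prime] (hlt : Nat.card {C : Subgroup G // IsCyclic C} < p) (P : Sylow p G) :
    (P : Subgroup G).Normal := by
  refine ⟨fun x hx g => ?_⟩
  have hQ : IsPGroup p (Subgroup.zpowers (g * x * g⁻¹)) := by
    have hc : orderOf (g * x * g⁻¹) = orderOf x := by
      simpa using orderOf_injective (MulAut.conj g).toMonoidHom (MulAut.conj g).injective x
    obtain ⟨k, hk⟩ := IsPGroup.iff_orderOf.1 P.isPGroup' ⟨x, hx⟩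
    refine IsPGroup.of_card (n := k) ?_
    rw [Nat.card_zpowers, hc, ← hk, ← Subgroup.orderOf_coe]
  have hsup := P.is_maximal' (P.isPGroup'.to_sup_of_normal_right' hQ
    (le_normalizer_of_isPGroup_of_card_lt hlt P.isPGroup' _)) le_sup_left
  exact hsup.le (Subgroup.mem_sup_right (Subgroup.mem_zpowers _))

theorem IsPGroup.isCyclic_of_card_cyclic_lt {P : Type*} [Group P] [Finite P] {p : ℕ}
    [hp : Fact p.Prime] (hP : IsPGroup p P)
    (hlt : Nat.card {C : Subgroup P // IsCyclic C} < p) : IsCyclic P := by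
  by_contra hcyc
  have hM (g : P) : orderOf g ≤ Nat.card P / p := by
    obtain ⟨d, hd⟩ := orderOf_dvd_natCard g
    obtain ⟨k, hk⟩ := hP.exists_card_eq
    -- The index of `⟨g⟩` is a power of `p` other than `1`.
    obtain ⟨j, -, hj⟩ := (Nat.dvd_prime_pow hp.out).1 (hk ▸ Dvd.intro_left _ hd.symm : d ∣ p ^ k)
    have hj0 : j ≠ 0 := by
      rintro rfl
      exact hcyc (isCyclic_of_orderOf_eq_card g (by rw [hd, hj]; simp))
    rw [Nat.le_div_iff_mul_le hp.out.pos, hd, hj]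
    exact Nat.mul_le_mul_left _ (Nat.le_self_pow hj0 p)
  have h1 := card_le_card_cyclic_mul hM
  have h2 := Nat.div_mul_le_self (Nat.card P) p
  have hpos : 0 < Nat.card P / p := (orderOf_pos (1 : P)).trans_le (hM 1)
  have h3 := Nat.mul_lt_mul_of_pos_right hlt hpos
  rw [mul_comm p] at h3
  omega

/-- If a prime divisor `p` of `|G|` exceeds the number of cyclic subgroups, then a Sylow
`p`-subgroup is a nontrivial cyclic coprime direct factor. -/
theorem exists_cyclic_coprime_direct_factor_of_card_cyclic_lt {G : Type*} [Group G] [Finite G]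
    {p : ℕ} [hp : Fact p.Prime] (hdvd : p ∣ Nat.card G)
    (hlt : Nat.card {C : Subgroup G // IsCyclic C} < p) :
    ∃ P K : Subgroup G, Nontrivial P ∧ IsCyclic P ∧ Nonempty (G ≃* P × K) ∧
      (Nat.card P).Coprime (Nat.card K) := by
  obtain ⟨P⟩ : Nonempty (Sylow p G) := inferInstance
  have hnormal := P.normal_of_card_cyclic_lt hlt
  obtain ⟨K, hK⟩ := Subgroup.exists_right_complement'_of_coprime P.card_coprime_index
  refine ⟨P, K, (Subgroup.nontrivial_iff_ne_bot _).2 (P.ne_bot_of_dvd_card hdvd),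
    P.isPGroup'.isCyclic_of_card_cyclic_lt ((card_cyclic_subgroup_le _).trans_lt hlt), ?_,
    hK.symm.index_eq_card ▸ P.card_coprime_index⟩
  have hcomm (x : (P : Subgroup G)) (k : K) :
      Commute ((P : Subgroup G).subtype x) (K.subtype k) := by
    -- The commutator of `x` and `k` lies in `P`, as `P` is normal, and in `⟨k⟩ ≤ K`, as `x`
    -- normalizes `⟨k⟩`.
    have hn := le_normalizer_of_isPGroup_of_card_lt hlt P.isPGroup'
      (Subgroup.zpowers (k : G)) x.2
    have h1 : (x : G) * k * (x : G)⁻¹ * (k : G)⁻¹ ∈ (P : Subgroup G) := by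
      rw [mul_assoc, mul_assoc, ← mul_assoc (k : G)]
      exact mul_mem x.2 (hnormal.conj_mem _ (inv_mem x.2) k)
    have h2 : (x : G) * k * (x : G)⁻¹ * (k : G)⁻¹ ∈ K :=
      mul_mem (Subgroup.zpowers_le.2 k.2 ((Subgroup.mem_normalizer_iff.1 hn _).1
        (Subgroup.mem_zpowers _))) (inv_mem k.2)
    have h3 := Subgroup.disjoint_def.1 hK.disjoint h1 h2
    exact mul_inv_eq_iff_eq_mul.1 (mul_inv_eq_one.1 h3)
  exact ⟨(MulEquiv.ofBijective
    (MonoidHom.noncommCoprod (P : Subgroup G).subtype K.subtype hcomm) hK).symm⟩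

/-! ### The bound on the order -/

theorem card_le_of_prime_le_card_cyclic {G : Type*} [Group G] [Finite G] {n : ℕ}
    (hn : Nat.card {C : Subgroup G // IsCyclic C} ≤ n)
    (hprime : ∀ p : ℕ, p.Prime → p ∣ Nat.card G → p ≤ n) :
    Nat.card G ≤ n * n.factorial ^ n := by
  have horder (g : G) : orderOf g ∣ n.factorial ^ n := by
    rw [← Nat.factorization_prime_le_iff_dvd (orderOf_pos g).ne'
      (pow_ne_zero _ n.factorial_ne_zero)]
    intro p hp
    by_cases hpg : p ∣ orderOf g
    · have h1 : 1 ≤ n.factorial.factorization p :=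
        (hp.dvd_iff_one_le_factorization n.factorial_ne_zero).1
          (Nat.dvd_factorial hp.pos (hprime p hp (hpg.trans (orderOf_dvd_natCard g))))
      calc (orderOf g).factorization p ≤ n :=
            ((factorization_orderOf_lt_card_cyclic g hp).trans_le hn).le
        _ ≤ n * n.factorial.factorization p := Nat.le_mul_of_pos_right _ h1
        _ = (n.factorial ^ n).factorization p := by simp [Nat.factorization_pow]
    · simp [Nat.factorization_eq_zero_of_not_dvd hpg]
  exact (card_le_card_cyclic_mul fun g =>
    Nat.le_of_dvd (pow_pos n.factorial_pos n) (horder g)).trans (Nat.mul_le_mul_right _ hn)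

/-- Up to isomorphism there are only finitely many groups of bounded order: each is isomorphic to a
group structure on some `Fin k`, which is determined by its multiplication table. -/
theorem finite_image_mk_of_card_le (N : ℕ) :
    (Quotient.mk finiteGrpIso.{u} '' {G | Nat.card G ≤ N}).Finite := by
  have (k : ℕ) : Finite (Group (Fin k)) :=
    Finite.of_injective (fun s : Group (Fin k) => s.mul) fun s t h => Group.ext h
  have hmk (G : FiniteGrp.{u}) (α : Type) [Group α] [Finite α] (e : α ≃* G) :
      Quotient.mk finiteGrpIso (FiniteGrp.of (ULift.{u} α)) = Quotient.mk finiteGrpIso G :=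
    Quotient.sound ⟨MulEquiv.ulift.trans e⟩
  let f : (Σ k : Fin (N + 1), Group (Fin k)) → Quotient finiteGrpIso.{u} := fun x =>
    letI := x.2
    Quotient.mk finiteGrpIso (FiniteGrp.of (ULift.{u} (Fin x.1)))
  refine (Set.finite_range f).subset ?_
  rintro _ ⟨G, hG, rfl⟩
  let e : Fin (Nat.card G) ≃ G := (Finite.equivFin G).symm
  -- The group structure is passed explicitly, as `Fin` carries another multiplication.
  exact ⟨⟨⟨Nat.card G, Nat.lt_succ_iff.2 hG⟩, e.group⟩,
    @hmk G (Fin (Nat.card G)) e.group _ e.mulEquiv⟩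

theorem theorem1p4 : IsCyclicBounded withoutCyclicCoprimeDirectFactors.{u} := by
  intro n
  refine (finite_image_mk_of_card_le (n * n.factorial ^ n)).subset (Set.image_mono ?_)
  rintro G ⟨hG, hn⟩
  refine card_le_of_prime_le_card_cyclic hn fun p hp hdvd => ?_
  by_contra! hlt
  have : Fact p.Prime := ⟨hp⟩
  obtain ⟨P, K, hP, hcyc, he, hcop⟩ :=
    exists_cyclic_coprime_direct_factor_of_card_cyclic_lt hdvd (lt_of_le_of_lt hn hlt)
  exact hG ⟨FiniteGrp.of P, hP, hcyc, FiniteGrp.of K, he, hcop⟩
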